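/- Let $p\in(0,1)$ be fixed, and let $G(n,p)$ be the random graph on the vertex set $\{1,\dots,n\}$ in which every pair of vertices is adjacent with probability $p$, independently of the other pairs. For graphs $F$ and $G$, a spanning subgraph $H\subseteq G$ is called $F$-saturated in $G$ if it is an inclusion-maximal $F$-free spanning subgraph of $G$ (that is, one containing no copy of $F$ as a subgraph), and $\mathrm{sat}(G,F)$ denotes the minimum number of edges of an $F$-saturated graph in $G$. Let $C_4$ be the cycle on four vertices. Then with high probability $$\mathrm{sat}\left(G(n,p),C_4\right)\ \geq\ \frac{3}{2}\,n\,(1+o(1)),$$ that is, there is a sequence of real numbers $\delta_n\to 0$ (possibly depending on $p$) such that $$\mathsf{P}\left(\mathrm{sat}\left(G(n,p),C_4\right)\geq \tfrac32\, n\,(1+\delta_n)\right)\to 1\quad\text{as } n\to\infty.$$ -/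

import Mathlib

open Filter Topology SimpleGraph

namespace SimpleGraph

/-- `H` is `F`-saturated in `G`: it is an inclusion-maximal `F`-free spanning subgraph of `G`
(all graphs on the same vertex set `V`; `F.Free H` says that `H` has no copy of `F` as a
not necessarily induced subgraph). -/
def IsSaturatedIn {V W : Type*} (F : SimpleGraph W) (G H : SimpleGraph V) : Prop :=
  Maximal (fun K : SimpleGraph V => K ≤ G ∧ F.Free K) H

/-- The saturation number `sat(G, F)`: the minimum number of edges of an `F`-saturated graph
in `G`. -/
noncomputable def satNumber {V W : Type*} (G : SimpleGraph V) (F : SimpleGraph W) : ℕ :=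
  sInf {m : ℕ | ∃ H : SimpleGraph V, IsSaturatedIn F G H ∧ H.edgeSet.ncard = m}

/-- If `F` has an edge, the minimum that defines `sat(G, F)` is attained. -/
theorem exists_isSaturatedIn_ncard_eq_satNumber {V W : Type*} [Finite V] (G : SimpleGraph V)
    {F : SimpleGraph W} (hF : F ≠ ⊥) :
    ∃ H : SimpleGraph V, IsSaturatedIn F G H ∧ H.edgeSet.ncard = satNumber G F := by
  have hbot : F.Free (⊥ : SimpleGraph V) := by
    rintro ⟨f⟩
    apply hF
    ext a b
    simp only [bot_adj, iff_false]
    intro hab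
    exact f.toHom.map_adj hab
  obtain ⟨H, -, hH⟩ := (Set.toFinite {K : SimpleGraph V | K ≤ G ∧ F.Free K}).exists_le_maximal
    (show (⊥ : SimpleGraph V) ∈ {K : SimpleGraph V | K ≤ G ∧ F.Free K} from ⟨bot_le, hbot⟩)
  exact Nat.sInf_mem
    (s := {m : ℕ | ∃ H : SimpleGraph V, IsSaturatedIn F G H ∧ H.edgeSet.ncard = m})
    ⟨_, H, hH, rfl⟩

end SimpleGraph

namespace SimpleGraph

variable {V : Type*}

/-- In a `C₄`-saturated subgraph, the ends of every missing edge are joined by a walk of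
length three. -/
theorem IsSaturatedIn.exists_walk_three {G H : SimpleGraph V}
    (h : IsSaturatedIn (cycleGraph 4) G H) {u v : V} (huv : G.Adj u v) (hn : ¬ H.Adj u v) :
    ∃ x y, H.Adj u x ∧ H.Adj x y ∧ H.Adj y v := by
  have hfree := h.prop.2
  have hle : H ⊔ edge u v ≤ G := sup_le h.prop.1 ((edge_le_iff _).2 (Or.inr huv))
  have hcon : (cycleGraph 4) ⊑ (H ⊔ edge u v) := by
    by_contra hc
    exact hn (h.le_of_ge ⟨hle, hc⟩ le_sup_left
      (Or.inr ((edge_adj ..).2 ⟨Or.inl ⟨rfl, rfl⟩, huv.ne⟩)))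
  obtain ⟨f⟩ := hcon
  have inj : ∀ {i j : Fin 4}, f i = f j → i = j := fun e => f.injective e
  have adj (i j : Fin 4) (hij : (cycleGraph 4).Adj i j) :
      H.Adj (f i) (f j) ∨ (f i = u ∧ f j = v ∨ f i = v ∧ f j = u) := by
    have := f.toHom.map_adj hij
    simp only [sup_adj, edge_adj, Copy.toHom_apply] at this
    tauto
  have e01 := adj 0 1 (by decide)
  have e12 := adj 1 2 (by decide)
  have e23 := adj 2 3 (by decide)
  have e30 := adj 3 0 (by decide)
  have n01 : f 0 ≠ f 1 := fun e => absurd (inj e) (by decide)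
  have n02 : f 0 ≠ f 2 := fun e => absurd (inj e) (by decide)
  have n03 : f 0 ≠ f 3 := fun e => absurd (inj e) (by decide)
  have n12 : f 1 ≠ f 2 := fun e => absurd (inj e) (by decide)
  have n13 : f 1 ≠ f 3 := fun e => absurd (inj e) (by decide)
  have n23 : f 2 ≠ f 3 := fun e => absurd (inj e) (by decide)
  have key (a b c d : V) (hbc : H.Adj b c) (hcd : H.Adj c d) (hda : H.Adj d a)
      (hab : a = u ∧ b = v ∨ a = v ∧ b = u) : ∃ x y, H.Adj u x ∧ H.Adj x y ∧ H.Adj y v := by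
    rcases hab with ⟨rfl, rfl⟩ | ⟨rfl, rfl⟩
    · exact ⟨d, c, hda.symm, hcd.symm, hbc.symm⟩
    · exact ⟨c, d, hbc, hcd, hda⟩
  by_cases hall : H.Adj (f 0) (f 1) ∧ H.Adj (f 1) (f 2) ∧ H.Adj (f 2) (f 3) ∧ H.Adj (f 3) (f 0)
  · obtain ⟨a, b, c, d⟩ := hall
    refine absurd ⟨⟨⟨f, ?_⟩, f.injective⟩⟩ hfree
    intro i j hij
    fin_cases i <;> fin_cases j <;> first
      | exact absurd hij (by decide)
      | assumption
      | (apply Adj.symm; assumption)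
  · have sep {a b c d : V} (hac : a ≠ c) (had : a ≠ d) (h1 : a = u ∧ b = v ∨ a = v ∧ b = u)
        (h2 : c = u ∧ d = v ∨ c = v ∧ d = u) : False := by
      rcases h1 with ⟨rfl, -⟩ | ⟨rfl, -⟩ <;> rcases h2 with ⟨rfl, rfl⟩ | ⟨rfl, rfl⟩ <;> contradiction
    rcases e01 with c01 | c01
    · rcases e12 with c12 | c12
      · rcases e23 with c23 | c23
        · exact key _ _ _ _ c01 c12 c23 (e30.resolve_left fun c30 => hall ⟨c01, c12, c23, c30⟩)
        · exact key _ _ _ _ (e30.resolve_right (sep n23 n02.symm c23)) c01 c12 c23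
      · exact key _ _ _ _ (e23.resolve_right (sep n12 n13 c12))
          (e30.resolve_right (sep n13 n01.symm c12)) c01 c12
    · exact key _ _ _ _ (e12.resolve_right (sep n01 n02 c01)) (e23.resolve_right (sep n02 n03 c01))
        (e30.resolve_right fun c => sep n03.symm n13.symm c c01) c01

open scoped Classical in
/-- If every independent set has at most `s` vertices, then a vertex set inducing a subgraph of
maximum degree at most `d` has at most `s * (d + 1)` vertices. -/
theorem card_le_of_forall_isIndepSet [Fintype V] (G : SimpleGraph V) {s d : ℕ} (S : Finset V)
    (hs : ∀ T : Finset V, G.IsIndepSet (T : Set V) → T.card ≤ s)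
    (hd : ∀ v ∈ S, (S.filter (G.Adj v)).card ≤ d) : S.card ≤ s * (d + 1) := by
  obtain ⟨I, -, hI⟩ := (Set.toFinite {T : Finset V | T ⊆ S ∧ G.IsIndepSet (T : Set V)}).exists_le_maximal
    (show (∅ : Finset V) ∈ _ from ⟨by simp, by simp [IsIndepSet]⟩)
  have hsub : S ⊆ I.biUnion fun v => insert v (S.filter (G.Adj v)) := by
    intro w hw
    by_cases hwI : w ∈ I
    · exact Finset.mem_biUnion.2 ⟨w, hwI, Finset.mem_insert_self _ _⟩
    by_contra hc
    simp only [Finset.mem_biUnion, Finset.mem_insert, Finset.mem_filter, not_exists, not_and,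
      not_or] at hc
    refine hwI (hI.le_of_ge (y := insert w I)
      ⟨Finset.insert_subset hw hI.prop.1, ?_⟩ (Finset.subset_insert w I)
      (Finset.mem_insert_self w I))
    rw [Finset.coe_insert, IsIndepSet, Set.pairwise_insert]
    refine ⟨hI.prop.2, fun b hb _ => ⟨fun h => (hc b hb).2 hw h.symm, fun h => (hc b hb).2 hw h⟩⟩
  calc S.card ≤ _ := Finset.card_le_card hsub
    _ ≤ I.card * (d + 1) := Finset.card_biUnion_le_card_mul _ _ _ fun v hv =>
        (Finset.card_insert_le _ _).trans (by gcongr; exact hd v (hI.prop.1 hv))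
    _ ≤ s * (d + 1) := by gcongr; exact hs I hI.prop.2

open scoped Classical in
/-- The vertices of degree at most two all of whose neighbours have degree below `K` are few in a
`C₄`-saturated subgraph of a graph with small independence number. -/
theorem IsSaturatedIn.card_filter_degree_le_two [Fintype V] {G H : SimpleGraph V}
    (h : IsSaturatedIn (cycleGraph 4) G H) {s : ℕ} (K : ℕ)
    (hs : ∀ T : Finset V, G.IsIndepSet (T : Set V) → T.card ≤ s) :
    (Finset.univ.filter fun v => H.degree v ≤ 2 ∧ ∀ w, H.Adj v w → H.degree w < K).card
      ≤ s * (2 * K ^ 2 + 3) := by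
  refine card_le_of_forall_isIndepSet G (d := 2 * K ^ 2 + 2) _ hs fun v hv => ?_
  rw [Finset.mem_filter] at hv
  have hsub : (Finset.univ.filter fun v => H.degree v ≤ 2 ∧ ∀ w, H.Adj v w → H.degree w < K).filter
      (G.Adj v) ⊆ H.neighborFinset v ∪ (H.neighborFinset v).biUnion fun x =>
        ((H.neighborFinset x).filter fun y => H.degree y < K).biUnion fun y =>
          H.neighborFinset y := by
    intro w hw
    simp only [Finset.mem_filter, Finset.mem_univ, true_and] at hw
    simp only [Finset.mem_union, Finset.mem_biUnion, mem_neighborFinset, Finset.mem_filter]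
    by_cases hvw : H.Adj v w
    · exact Or.inl hvw
    obtain ⟨x, y, h1, h2, h3⟩ := h.exists_walk_three hw.2 hvw
    exact Or.inr ⟨x, h1, y, ⟨h2, hw.1.2 y h3.symm⟩, h3⟩
  calc _ ≤ _ := Finset.card_le_card hsub
    _ ≤ _ := Finset.card_union_le _ _
    _ ≤ 2 + 2 * (K * K) := by
        refine add_le_add hv.2.1 ((Finset.card_biUnion_le_card_mul _ _ (K * K) fun x hx => ?_).trans
          (Nat.mul_le_mul_right _ hv.2.1))
        refine (Finset.card_biUnion_le_card_mul _ _ K fun y hy => ?_).trans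
          (Nat.mul_le_mul_right _ ?_)
        · exact (Finset.mem_filter.1 hy).2.le
        · exact (Finset.card_filter_le _ _).trans (hv.2.2 x ((mem_neighborFinset ..).1 hx)).le
    _ = _ := by ring

open scoped Classical in
/-- The leaves hanging on vertices of a set `B` are at most `s * #B` in number if every
independent set has at most `s` vertices. -/
theorem IsSaturatedIn.card_filter_degree_eq_one [Fintype V] {G H : SimpleGraph V}
    (h : IsSaturatedIn (cycleGraph 4) G H) {s : ℕ} (B : Finset V)
    (hs : ∀ T : Finset V, G.IsIndepSet (T : Set V) → T.card ≤ s) :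
    (Finset.univ.filter fun v => H.degree v = 1 ∧ ∃ w ∈ B, H.Adj v w).card ≤ s * B.card := by
  have hsub : (Finset.univ.filter fun v => H.degree v = 1 ∧ ∃ w ∈ B, H.Adj v w) ⊆
      B.biUnion fun w => Finset.univ.filter fun v => H.degree v = 1 ∧ H.Adj v w := by
    intro v hv
    simp only [Finset.mem_filter, Finset.mem_univ, true_and, Finset.mem_biUnion] at hv ⊢
    obtain ⟨h1, w, hw, hvw⟩ := hv
    exact ⟨w, hw, h1, hvw⟩
  refine (Finset.card_le_card hsub).trans ?_
  rw [mul_comm]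
  refine Finset.card_biUnion_le_card_mul _ _ _ fun w hw => hs _ ?_
  intro a ha b hb hab hG
  simp only [Finset.coe_filter, Finset.mem_univ, true_and, Set.mem_ofPred_eq] at ha hb
  have uniq {v x : V} (hv : H.degree v = 1 ∧ H.Adj v w) (hx : H.Adj v x) : x = w :=
    (degree_eq_one_iff_existsUnique_adj.1 hv.1).unique hx hv.2
  have hn : ¬ H.Adj a b := fun hadj => by
    have := uniq ha hadj
    subst this
    exact hb.2.ne rfl
  obtain ⟨x, y, h1, h2, h3⟩ := h.exists_walk_three hG hn
  have hx := uniq ha h1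
  have hy := uniq hb h3.symm
  exact h2.ne (hx.trans hy.symm)

/-- A lower bound for the number of edges of a `C₄`-saturated subgraph of a graph all of whose
independent sets have at most `s` vertices. -/
theorem IsSaturatedIn.three_mul_card_le [Fintype V] {G H : SimpleGraph V}
    (h : IsSaturatedIn (cycleGraph 4) G H) {s : ℕ} (K : ℕ)
    (hs : ∀ T : Finset V, G.IsIndepSet (T : Set V) → T.card ≤ s) :
    K * (3 * Fintype.card V) ≤ (K + 3 * (s + 1)) * (2 * H.edgeSet.ncard) +
      K * (3 * (s * (2 * K ^ 2 + 3))) := by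
  classical
  set B := Finset.univ.filter fun v => K ≤ H.degree v with hB
  set S := Finset.univ.filter fun v => H.degree v ≤ 2 ∧ ∀ w, H.Adj v w → H.degree w < K with hS
  set L := Finset.univ.filter fun v => H.degree v = 1 ∧ ∃ w ∈ B, H.Adj v w with hL
  set D := Finset.univ.filter fun v => H.degree v = 2 ∧ ∃ w ∈ B, H.Adj v w with hD
  have cS : S.card ≤ s * (2 * K ^ 2 + 3) := by
    convert h.card_filter_degree_le_two K hs
  have cL : L.card ≤ s * B.card := by
    convert h.card_filter_degree_eq_one B hs
  have cD : D.card ≤ ∑ w ∈ B, H.degree w := by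
    have hsub : D ⊆ B.biUnion fun w => H.neighborFinset w := by
      intro v hv
      simp only [hD, Finset.mem_filter, Finset.mem_univ, true_and] at hv
      obtain ⟨-, w, hw, hvw⟩ := hv
      exact Finset.mem_biUnion.2 ⟨w, hw, (mem_neighborFinset ..).2 hvw.symm⟩
    exact (Finset.card_le_card hsub).trans Finset.card_biUnion_le
  have hsum : ∑ v, H.degree v = 2 * H.edgeSet.ncard := by
    rw [sum_degrees_eq_twice_card_edges, ← coe_edgeFinset, Set.ncard_coe_finset]
  have cB : K * B.card ≤ 2 * H.edgeSet.ncard := by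
    rw [← hsum, mul_comm]
    calc B.card * K = ∑ w ∈ B, K := by simp
      _ ≤ ∑ w ∈ B, H.degree w := Finset.sum_le_sum fun w hw => (Finset.mem_filter.1 hw).2
      _ ≤ _ := Finset.sum_le_sum_of_subset (Finset.subset_univ _)
  have hpt (v : V) : 3 ≤ (if v ∈ B then 0 else H.degree v) + (if v ∈ D then 1 else 0) +
      3 * (if v ∈ S then 1 else 0) + 3 * (if v ∈ L then 1 else 0) +
      3 * (if v ∈ B then 1 else 0) := by
    by_cases vB : v ∈ B
    · simp [vB]
    by_cases vS : v ∈ S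
    · simp [vS]; omega
    by_cases h3 : 3 ≤ H.degree v
    · simp [vB]; omega
    have hex : ∃ w ∈ B, H.Adj v w := by
      by_contra hc
      push Not at hc
      refine vS (Finset.mem_filter.2 ⟨Finset.mem_univ _, by omega, fun w hw => ?_⟩)
      by_contra hlt
      exact hc w (Finset.mem_filter.2 ⟨Finset.mem_univ _, by omega⟩) hw
    have hpos : 0 < H.degree v := by
      obtain ⟨w, -, hw⟩ := hex
      exact (degree_pos_iff_exists_adj _ _).2 ⟨w, hw⟩
    rcases (by omega : H.degree v = 1 ∨ H.degree v = 2) with h1 | h2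
    · have : v ∈ L := Finset.mem_filter.2 ⟨Finset.mem_univ _, h1, hex⟩
      simp [this]; omega
    · have : v ∈ D := Finset.mem_filter.2 ⟨Finset.mem_univ _, h2, hex⟩
      simp [this, vB, h2]; omega
  have htot := Finset.sum_le_sum fun v (_ : v ∈ Finset.univ) => hpt v
  have hsplit : ∑ v, (if v ∈ B then 0 else H.degree v) + ∑ w ∈ B, H.degree w
      = 2 * H.edgeSet.ncard := by
    rw [← hsum, ← Finset.sum_filter_add_sum_filter_not Finset.univ (· ∈ B) (fun v => H.degree v),
      add_comm, Finset.filter_mem_eq_inter, Finset.univ_inter]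
    congr 1
    rw [Finset.sum_filter]
    simp only [ite_not]
  simp only [Finset.sum_add_distrib, ← Finset.mul_sum, Finset.sum_boole, Finset.sum_const,
    Finset.card_univ, smul_eq_mul, Finset.filter_mem_eq_inter, Finset.univ_inter,
    Nat.cast_id] at htot
  have hmain : 3 * Fintype.card V ≤ 2 * H.edgeSet.ncard + 3 * (s * (2 * K ^ 2 + 3)) +
      3 * ((s + 1) * B.card) := by
    have : (s + 1) * B.card = s * B.card + B.card := by ring
    omega
  calc K * (3 * Fintype.card V) ≤ K * (2 * H.edgeSet.ncard + 3 * (s * (2 * K ^ 2 + 3)) +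
      3 * ((s + 1) * B.card)) := by gcongr
    _ = K * (2 * H.edgeSet.ncard) + K * (3 * (s * (2 * K ^ 2 + 3))) +
      3 * (s + 1) * (K * B.card) := by ring
    _ ≤ K * (2 * H.edgeSet.ncard) + K * (3 * (s * (2 * K ^ 2 + 3))) +
      3 * (s + 1) * (2 * H.edgeSet.ncard) := by gcongr
    _ = _ := by ring

end SimpleGraph

section RandomGraph

theorem Finset.sym2_filter_not_isDiag {α : Type*} [DecidableEq α] (T : Finset α) :
    (T.sym2.filter fun e => ¬ e.IsDiag) = T.offDiag.image Sym2.mk.uncurry := by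
  ext e
  induction e with | _ a b =>
  simp only [Finset.mem_filter, Finset.mk_mem_sym2_iff, Sym2.mk_isDiag_iff, Finset.mem_image,
    Finset.mem_offDiag, Prod.exists, Function.uncurry_apply_pair, Sym2.eq_iff]
  grind

open MeasureTheory ProbabilityTheory unitInterval

/-- The probability that a fixed vertex set is independent in the binomial random graph. -/
theorem SimpleGraph.binomialRandom_isIndepSet {V : Type*} [Finite V] (p : unitInterval)
    (T : Finset V) :
    G(V, p) {G | G.IsIndepSet (T : Set V)} = (toNNReal (σ p) : ENNReal) ^ T.card.choose 2 := by
  classical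
  cases nonempty_fintype V
  have himg : edgeSet '' {G : SimpleGraph V | G.IsIndepSet (T : Set V)} =
      {E | E ∈ (fun E : Set (Sym2 V) => fun e => e ∈ E) ⁻¹'
        (Set.pi ↑(T.sym2.filter fun e => ¬ e.IsDiag) fun _ => {False}) ∧ E ⊆ Sym2.diagSetᶜ} := by
    ext E
    simp only [Set.mem_image, Set.mem_ofPred_eq, Set.mem_preimage, Set.mem_pi,
      Finset.coe_filter, Finset.mem_sym2_iff, Set.mem_singleton_iff, eq_iff_iff, iff_false]
    constructor
    · rintro ⟨G, hG, rfl⟩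
      refine ⟨fun e => ?_, by simp⟩
      induction e with | _ a b =>
      rintro ⟨hab, hd⟩ hadj
      exact hG (hab a (by simp)) (hab b (by simp)) (by simpa using hd) hadj
    · rintro ⟨h, hE⟩
      refine ⟨fromEdgeSet E, fun a ha b hb hab hadj => ?_, ?_⟩
      · refine h s(a, b) ⟨?_, by simpa using hab⟩ (by simpa using hadj.1)
        simp only [Sym2.mem_iff]
        rintro x (rfl | rfl) <;> simpa
      · rw [edgeSet_fromEdgeSet]
        ext e
        simp only [Set.mem_sdiff, and_iff_left_iff_imp]
        exact fun he => hE he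
  rw [binomialRandom_apply', himg, ← setBernoulli_apply_eq_apply_subsets, setBernoulli_apply']
  have hpre : ((fun q : Sym2 V → Prop => {i | q i}) ⁻¹'
      ((fun E : Set (Sym2 V) => fun e => e ∈ E) ⁻¹'
        (Set.pi ↑(T.sym2.filter fun e => ¬ e.IsDiag) fun _ => {False}))) =
      (Set.pi ↑(T.sym2.filter fun e => ¬ e.IsDiag) fun _ => {False}) := rfl
  rw [hpre, Measure.infinitePi_pi _ (fun _ _ => .of_discrete)]
  rw [Finset.prod_congr rfl (g := fun _ => (toNNReal (σ p) : ENNReal)), Finset.prod_const]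
  · congr 1
    rw [Finset.sym2_filter_not_isDiag, Sym2.card_image_offDiag]
  · intro e he
    have := (Finset.mem_filter.1 he).2
    simp [this]

/-- First moment bound for the existence of an independent set of size `k`. -/
theorem SimpleGraph.binomialRandom_exists_isIndepSet_le (p : unitInterval) (n k : ℕ) :
    G(Fin n, p) {G | ∃ T : Finset (Fin n), T.card = k ∧ G.IsIndepSet (T : Set (Fin n))} ≤
      (n : ENNReal) ^ k * (toNNReal (σ p) : ENNReal) ^ k.choose 2 := by
  have hU : {G : SimpleGraph (Fin n) | ∃ T : Finset (Fin n), T.card = k ∧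
      G.IsIndepSet (T : Set (Fin n))} =
      ⋃ T ∈ Finset.powersetCard k (Finset.univ : Finset (Fin n)),
        {G : SimpleGraph (Fin n) | G.IsIndepSet (T : Set (Fin n))} := by
    ext G; simp
  rw [hU]
  refine (measure_biUnion_finset_le _ _).trans ?_
  rw [Finset.sum_congr rfl (g := fun _ => (toNNReal (σ p) : ENNReal) ^ k.choose 2),
    Finset.sum_const, Finset.card_powersetCard, Finset.card_univ, Fintype.card_fin, nsmul_eq_mul]
  · gcongr
    exact_mod_cast Nat.choose_le_pow n k
  · intro T hT
    rw [binomialRandom_isIndepSet, (Finset.mem_powersetCard.1 hT).2]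

end RandomGraph

section Asymptotics

open Real

/-- A slowly growing bound for the independence number of a random graph on `n` vertices. -/
noncomputable def logSqFloor (n : ℕ) : ℕ := ⌊log n ^ 2⌋₊

theorem tendsto_log_natCast : Tendsto (fun n : ℕ => log n) atTop atTop :=
  tendsto_log_atTop.comp tendsto_natCast_atTop_atTop

theorem tendsto_logSqFloor : Tendsto logSqFloor atTop atTop :=
  tendsto_nat_floor_atTop.comp ((tendsto_pow_atTop two_ne_zero).comp tendsto_log_natCast)

theorem tendsto_logSqFloor_pow_div (k : ℕ) :
    Tendsto (fun n : ℕ => (logSqFloor n : ℝ) ^ k / n) atTop (𝓝 0) := by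
  have h : Tendsto (fun n : ℕ => log n ^ (2 * k) / n) atTop (𝓝 0) :=
    (isLittleO_pow_log_id_atTop (n := 2 * k)).tendsto_div_nhds_zero.comp
      tendsto_natCast_atTop_atTop
  refine squeeze_zero (fun n => by positivity) (fun n => ?_) h
  rw [pow_mul]
  gcongr
  exact Nat.floor_le (sq_nonneg _)

theorem tendsto_mul_pow_logSqFloor {r : ℝ} (h0 : 0 < r) (h1 : r < 1) :
    Tendsto (fun n : ℕ => (n : ℝ) * r ^ logSqFloor n) atTop (𝓝 0) := by
  have hc : 0 < -log r := neg_pos.2 (log_neg h0 h1)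
  have hbot : Tendsto (fun n : ℕ => log n * (1 + log n * log r) + -log r) atTop atBot := by
    refine tendsto_atBot_add_const_right _ _ (tendsto_log_natCast.atTop_mul_atBot₀ ?_)
    exact tendsto_atBot_add_const_left _ _ (tendsto_log_natCast.atTop_mul_const_of_neg (by linarith))
  refine squeeze_zero' (.of_forall fun n => by positivity) ?_ (tendsto_exp_atBot.comp hbot)
  filter_upwards [eventually_ge_atTop 1] with n hn
  have hn' : (0 : ℝ) < n := by exact_mod_cast hn
  have hfl : log n ^ 2 - 1 ≤ (logSqFloor n : ℝ) := (Nat.sub_one_lt_floor _).le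
  rw [Function.comp_apply, ← exp_log (show 0 < (n : ℝ) * r ^ logSqFloor n by positivity),
    log_mul hn'.ne' (by positivity), log_pow]
  refine exp_le_exp.2 ?_
  nlinarith

theorem tendsto_one_sub_mul_sq_div : Tendsto (fun n : ℕ =>
    (1 - (2 * (logSqFloor n : ℝ) ^ 5 + 3 * logSqFloor n) / n) *
      ((logSqFloor n : ℝ) ^ 2 / ((logSqFloor n : ℝ) ^ 2 + 3 * logSqFloor n + 3)) - 1)
    atTop (𝓝 0) := by
  have hs : Tendsto (fun n => (logSqFloor n : ℝ)) atTop atTop :=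
    tendsto_natCast_atTop_atTop.comp tendsto_logSqFloor
  have hinv := tendsto_inv_atTop_zero.comp hs
  have h1 : Tendsto (fun n : ℕ => 1 - (2 * (logSqFloor n : ℝ) ^ 5 + 3 * logSqFloor n) / n)
      atTop (𝓝 1) := by
    have := (((tendsto_logSqFloor_pow_div 5).const_mul 2).add
      ((tendsto_logSqFloor_pow_div 1).const_mul 3)).const_sub 1
    simp only [mul_zero, add_zero, sub_zero] at this
    exact this.congr fun n => by ring
  have h2 : Tendsto (fun n : ℕ => (logSqFloor n : ℝ) ^ 2 /
      ((logSqFloor n : ℝ) ^ 2 + 3 * logSqFloor n + 3)) atTop (𝓝 1) := by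
    have := (((hinv.const_mul 3).const_add 1).add ((hinv.pow 2).const_mul 3)).inv₀ (by norm_num)
    simp only [Function.comp_apply, mul_zero, add_zero, ne_eq, OfNat.ofNat_ne_zero,
      not_false_eq_true, zero_pow, inv_one] at this
    refine this.congr' ?_
    filter_upwards [tendsto_logSqFloor.eventually_ge_atTop 1] with n hn
    have : (0 : ℝ) < logSqFloor n := by exact_mod_cast hn
    field_simp
  simpa using (h1.mul h2).sub_const 1

open MeasureTheory ProbabilityTheory unitInterval

/-- With high probability `G(n, p)` has no independent set of more than `log² n` vertices. -/
theorem tendsto_binomialRandom_exists_isIndepSet (p : unitInterval) (hp0 : 0 < p) (hp1 : p < 1) :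
    Tendsto (fun n : ℕ => G(Fin n, p) {G | ∃ T : Finset (Fin n),
      T.card = logSqFloor n + 1 ∧ G.IsIndepSet (T : Set (Fin n))}) atTop (𝓝 0) := by
  have hq0 : (0 : ℝ) < 1 - p := sub_pos.2 hp1
  have hq1 : (1 : ℝ) - p < 1 := sub_lt_self _ hp0
  have ht := tendsto_mul_pow_logSqFloor (sqrt_pos.2 hq0)
    ((sqrt_lt' one_pos).2 (by rwa [one_pow]))
  refine tendsto_of_tendsto_of_tendsto_of_le_of_le' tendsto_const_nhds
    (ENNReal.ofReal_zero ▸ ENNReal.tendsto_ofReal ht) (.of_forall fun _ => zero_le) ?_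
  filter_upwards [ht.eventually_le_const one_pos] with n hn
  refine (binomialRandom_exists_isIndepSet_le p n _).trans ?_
  set s := logSqFloor n
  have hσ : (unitInterval.toNNReal (σ p) : ENNReal) = ENNReal.ofReal (1 - p) := by
    rw [← ENNReal.ofReal_coe_nnreal]
    rfl
  have hn' : (n : ENNReal) = ENNReal.ofReal n := by simp
  rw [hσ, hn', ← ENNReal.ofReal_pow (by positivity), ← ENNReal.ofReal_pow hq0.le,
    ← ENNReal.ofReal_mul (by positivity)]
  refine ENNReal.ofReal_le_ofReal ?_
  have hpow : (1 - (p : ℝ)) ^ (s + 1).choose 2 = (√(1 - p) ^ s) ^ (s + 1) := by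
    nth_rewrite 1 [← sq_sqrt hq0.le]
    rw [← pow_mul, ← pow_mul]
    congr 1
    rw [Nat.choose_two_right, Nat.mul_div_cancel' (Nat.even_mul_pred_self _).two_dvd,
      Nat.add_sub_cancel, mul_comm]
  rw [hpow, ← mul_pow]
  exact pow_le_of_le_one (by positivity) hn (by omega)

end Asymptotics

/-- A lower bound for the `C₄`-saturation number of a graph with small independence number. -/
theorem SimpleGraph.le_satNumber_cycleGraph_four {V : Type*} [Fintype V] [Nonempty V]
    (G : SimpleGraph V) {s : ℕ}
    (hs : ∀ T : Finset V, G.IsIndepSet (T : Set V) → T.card ≤ s) :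
    3 / 2 * (Fintype.card V : ℝ) * ((1 - (2 * (s : ℝ) ^ 5 + 3 * s) / Fintype.card V) *
      ((s : ℝ) ^ 2 / ((s : ℝ) ^ 2 + 3 * s + 3))) ≤ satNumber G (cycleGraph 4) := by
  have hne : cycleGraph 4 ≠ ⊥ := fun h => by
    have h01 : (cycleGraph 4).Adj 0 1 := by decide
    rw [h] at h01
    exact h01
  obtain ⟨H, hH, hcard⟩ := exists_isSaturatedIn_ncard_eq_satNumber G hne
  have hmain := hH.three_mul_card_le (s ^ 2) hs
  rw [hcard] at hmain
  have hmainR : (s : ℝ) ^ 2 * (3 * Fintype.card V) ≤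
      ((s : ℝ) ^ 2 + 3 * (s + 1)) * (2 * satNumber G (cycleGraph 4)) +
        (s : ℝ) ^ 2 * (3 * (s * (2 * ((s : ℝ) ^ 2) ^ 2 + 3))) := by exact_mod_cast hmain
  have hn : (0 : ℝ) < Fintype.card V := by exact_mod_cast Fintype.card_pos
  have hd : (0 : ℝ) < (s : ℝ) ^ 2 + 3 * s + 3 := by positivity
  have heq : 3 / 2 * (Fintype.card V : ℝ) * ((1 - (2 * (s : ℝ) ^ 5 + 3 * s) / Fintype.card V) *
      ((s : ℝ) ^ 2 / ((s : ℝ) ^ 2 + 3 * s + 3))) =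
      3 / 2 * (Fintype.card V - (2 * (s : ℝ) ^ 5 + 3 * s)) * (s : ℝ) ^ 2 /
        ((s : ℝ) ^ 2 + 3 * s + 3) := by
    field_simp
  rw [heq, div_le_iff₀ hd]
  linarith

theorem theorem3 (p : unitInterval) (hp0 : 0 < p) (hp1 : p < 1) :
    ∃ δ : ℕ → ℝ, Tendsto δ atTop (𝓝 0) ∧
      Tendsto (fun n : ℕ => G(Fin n, p)
          {G : SimpleGraph (Fin n) |
            3 / 2 * (n : ℝ) * (1 + δ n) ≤ (satNumber G (cycleGraph 4) : ℝ)})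
        atTop (𝓝 1) := by
  refine ⟨_, tendsto_one_sub_mul_sq_div, ?_⟩
  have hlow := ENNReal.Tendsto.sub (tendsto_const_nhds (x := (1 : ENNReal)))
    (tendsto_binomialRandom_exists_isIndepSet p hp0 hp1) (Or.inl ENNReal.one_ne_top)
  rw [tsub_zero] at hlow
  refine tendsto_of_tendsto_of_tendsto_of_le_of_le' hlow tendsto_const_nhds ?_
    (.of_forall fun n => MeasureTheory.prob_le_one)
  filter_upwards [eventually_ge_atTop 1] with n hn
  have : Nonempty (Fin n) := ⟨⟨0, hn⟩⟩
  rw [tsub_le_iff_right, ← MeasureTheory.measure_univ (μ := G(Fin n, p))]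
  refine (MeasureTheory.measure_mono fun G _ => ?_).trans (MeasureTheory.measure_union_le _ _)
  by_cases hG : ∃ T : Finset (Fin n), T.card = logSqFloor n + 1 ∧ G.IsIndepSet (T : Set (Fin n))
  · exact Or.inr hG
  · refine Or.inl ?_
    have hbound := G.le_satNumber_cycleGraph_four fun T hT => by
      by_contra hlt
      obtain ⟨U, hUT, hU⟩ := Finset.exists_subset_card_eq (Nat.succ_le_of_lt (not_le.1 hlt))
      exact hG ⟨U, hU, hT.mono (Finset.coe_subset.2 hUT)⟩
    rw [Fintype.card_fin] at hbound
    rw [Set.mem_ofPred_eq, add_sub_cancel]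
    exact hbound
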